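/- Let $m$ be Lebesgue measure on $[0,1]$, let $S:[0,1]\to[0,1]$ be an automorphism of $([0,1],m)$ (an invertible, bimeasurable, $m$-preserving transformation), and let $r:[0,1]\to[0,\infty)$ be a measurable, $m$-integrable function. Let $X=\{(a,b): a\in[0,1],\ 0\le b<r(a)\}$ be the region under the graph of $r$, with the normalized area measure $\mu$, and let $(T_t)_{t\in\mathbb R}$ be the special flow over $S$ with roof function $r$: each point of $X$ moves vertically upward with unit speed, $T_t(a,b)=(a,b+t)$, the points $(a,r(a))$ and $(S(a),0)$ being identified. (The flow is determined for all times on almost every point; on the exceptional null set of vertical lines that cannot be followed for all times it is taken to be the identity.) Assume that the flow $T_t$ is ergodic with respect to $\mu$. Let $f\in L_1(X,\mu)$ satisfy $\int_X f\,d\mu=0$, and let $A\subset X$ be a $\mu$-measurable set. Then for $\mu$-almost every $x\in A$ with $f(x)\neq 0$ there is a sequence $t_k\to+\infty$ such that, for every $k$, the function $s\mapsto f(T_sx)$ is integrable on $[0,t_k]$ and $$\Phi(t_k,x):=\int_0^{t_k} f(T_sx)\,ds=0,\qquad T_{t_k}x\in A.$$ -/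

import Mathlib

open MeasureTheory Filter Set
open scoped unitInterval

namespace SpecialFlow

/-- The roof cocycle: `∑ i < n, r (S^i a)` for `n ≥ 0` and `-∑ 1 ≤ i ≤ -n, r (S^(-i) a)` for
`n < 0`. It is the (signed) time at which the vertical line started at `(a, 0)` arrives at the
base point `S^n a`. -/
def roofSum (S : I ≃ᵐ I) (r : I → ℝ) (a : I) : ℤ → ℝ
  | Int.ofNat n => ∑ i ∈ Finset.range n, r ((S.toEquiv ^ (i : ℤ) : Equiv.Perm I) a)
  | Int.negSucc n =>
      -∑ i ∈ Finset.range (n + 1), r ((S.toEquiv ^ (-((i : ℤ) + 1)) : Equiv.Perm I) a)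

theorem roofSum_add_one (S : I ≃ᵐ I) (r : I → ℝ) (a : I) (n : ℤ) :
    roofSum S r a (n + 1) = roofSum S r a n + r ((S.toEquiv ^ n : Equiv.Perm I) a) := by
  rcases n with n | n
  · have h : Int.ofNat n + 1 = Int.ofNat (n + 1) := by simp
    rw [h]
    simp only [roofSum, Finset.sum_range_succ]
    rfl
  · rcases n with _ | n
    · have h : Int.negSucc 0 + 1 = Int.ofNat 0 := by decide
      rw [h]
      simp [roofSum]
    · have h : Int.negSucc (n + 1) + 1 = Int.negSucc n := by omega
      have h2 : (-(((n + 1 : ℕ) : ℤ) + 1)) = Int.negSucc (n + 1) := by omega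
      rw [h]
      simp only [roofSum]
      rw [Finset.sum_range_succ _ (n + 1), h2]
      ring

/-- The region under the graph of the roof function `r`. The point `(a, r a)` of the upper
boundary is represented by the point `(S a, 0)` with which it is identified. -/
def phaseSpace (r : I → ℝ) : Set (I × ℝ) :=
  {p | 0 ≤ p.2 ∧ p.2 < r p.1}

/-- The normalized area measure on the phase space. -/
noncomputable def phaseMeasure (r : I → ℝ) : Measure (phaseSpace r) :=
  (volume (phaseSpace r))⁻¹ • (volume : Measure (I × ℝ)).comap Subtype.val

/-- The vertical line through the base point `a` can be followed for all positive and negative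
times. If `S` preserves Lebesgue measure and `r ≥ 0` is measurable, this holds for almost every
`a` with `r a > 0`. -/
def IsComplete (S : I ≃ᵐ I) (r : I → ℝ) (a : I) : Prop :=
  ∀ u : ℝ, ∃ n : ℤ, roofSum S r a n ≤ u ∧ u < roofSum S r a (n + 1)

open Classical in
/-- The special flow over `S` under `r`: a point moves vertically upwards with unit speed and
passes from `(a, r a)` to `(S a, 0)`, that is, `T_t (a, b) = (S^n a, b + t - roofSum n a)` where
`n` is the integer with `roofSum n a ≤ b + t < roofSum (n + 1) a`. Points on lines which
cannot be followed for all times (a null set) are kept fixed. -/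
noncomputable def flow (S : I ≃ᵐ I) (r : I → ℝ) (t : ℝ) (x : phaseSpace r) : phaseSpace r :=
  if h : IsComplete S r x.1.1 then
    ⟨((S.toEquiv ^ (h (x.1.2 + t)).choose : Equiv.Perm I) x.1.1,
        x.1.2 + t - roofSum S r x.1.1 (h (x.1.2 + t)).choose), by
      have h1 := (h (x.1.2 + t)).choose_spec
      rw [roofSum_add_one] at h1
      exact ⟨sub_nonneg.2 h1.1, by linarith [h1.2]⟩⟩
  else x

/-- Ergodicity of a flow: every invariant measurable set is null or conull. -/
def IsErgodicFlow {X : Type*} [MeasurableSpace X] (T : ℝ → X → X) (μ : Measure X) : Prop :=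
  ∀ B : Set X, MeasurableSet B → (∀ t : ℝ, T t ⁻¹' B = B) → μ B = 0 ∨ μ Bᶜ = 0

/-- `Φ(t, x) = ∫_0^t f (T_s x) ds`. -/
noncomputable def orbitIntegral {X : Type*} (T : ℝ → X → X) (f : X → ℝ) (t : ℝ) (x : X) : ℝ :=
  ∫ s in (0 : ℝ)..t, f (T s x)

end SpecialFlow

/-!
A coboundary `g - g ∘ T s` has bounded orbit integrals, and for an ergodic flow such functions are
dense among the integrable functions of mean zero. Hence the maximum of `|Φ(t, x)|` over
`0 ≤ t ≤ L` is `o(L)` in mean.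

By Lebesgue differentiation along the orbits, at almost every point where `f ≠ 0` the map
`t ↦ Φ(t, x)` expands short time distances by some positive factor. Suppose that the points of a
set `B`, all with the same factor, have no zero of `Φ` at a time `t ≥ N` of return to `B`. On the
visits of an orbit to `B` during short time windows separated by gaps of length `N`, the map
`Φ(·, x)` is then injective and expanding, so up to time `L` its range has, in mean, length at least
a constant times `L * μ B`. This range lies within the maximal orbit integral, which is `o(L)`, so
`B` is null.

The special flow is the quotient of the vertical translation of `I × ℝ` by the measure preserving
shift `(a, b) ↦ (S a, b - r a)`, whence it preserves the area.
-/

namespace SpecialFlow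

open scoped ENNReal NNReal Topology

section AbstractFlow

variable {X : Type*} [MeasurableSpace X] {T : ℝ → X → X} {μ : Measure X}

/-- A jointly measurable action of the additive group `ℝ`, written as a family of maps `T t`. -/
structure IsMeasurableFlow (T : ℝ → X → X) : Prop where
  measurable_uncurry : Measurable (Function.uncurry T)
  map_zero : ∀ x, T 0 x = x
  map_add : ∀ s t x, T (s + t) x = T t (T s x)

/-- A measurable flow all of whose time `t` maps preserve the measure `μ`. -/
structure IsMeasurePreservingFlow (T : ℝ → X → X) (μ : Measure X) : Prop
    extends IsMeasurableFlow T where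
  measurePreserving : ∀ t, MeasurePreserving (T t) μ μ

namespace IsMeasurableFlow

theorem measurable_orbit (hT : IsMeasurableFlow T) (x : X) : Measurable fun s => T s x :=
  hT.measurable_uncurry.comp measurable_prodMk_right

theorem measurable_map (hT : IsMeasurableFlow T) (t : ℝ) : Measurable (T t) :=
  hT.measurable_uncurry.comp measurable_prodMk_left

theorem measurable_uncurry_flip (hT : IsMeasurableFlow T) :
    Measurable (Function.uncurry fun x s => T s x) :=
  hT.measurable_uncurry.comp measurable_swap

theorem map_neg_map (hT : IsMeasurableFlow T) (t : ℝ) (x : X) : T (-t) (T t x) = x := by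
  rw [← hT.map_add, add_neg_cancel, hT.map_zero]

theorem ae_map_map_iff (hT : IsMeasurableFlow T) (p : X → Prop) (t : ℝ) (x : X) :
    (∀ᵐ s : ℝ, p (T s (T t x))) ↔ ∀ᵐ s : ℝ, p (T s x) := by
  simp only [← hT.map_add, add_comm t]
  rw [← (measurableEmbedding_addRight t).ae_map_iff (p := fun s => p (T s x)),
    map_add_right_eq_self]

end IsMeasurableFlow

namespace IsMeasurePreservingFlow

theorem ae_ae_orbit [SFinite μ] (hT : IsMeasurePreservingFlow T μ) {p : X → Prop}
    (hp : ∀ᵐ x ∂μ, p x) : ∀ᵐ x ∂μ, ∀ᵐ s : ℝ, p (T s x) := by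
  obtain ⟨Z, hpZ, hZ, hZ0⟩ := exists_measurable_superset_of_null (ae_iff.1 hp)
  have hTZ : ∀ s, ∀ᵐ x ∂μ, T s x ∉ Z := fun s =>
    (hT.measurePreserving s).quasiMeasurePreserving.ae (measure_eq_zero_iff_ae_notMem.1 hZ0)
  have hZorbit : ∀ᵐ x ∂μ, ∀ᵐ s : ℝ, T s x ∉ Z :=
    (Measure.ae_ae_comm (p := fun s x => T s x ∉ Z) (hT.measurable_uncurry hZ.compl)).1
      (.of_forall hTZ)
  filter_upwards [hZorbit] with x hx
  filter_upwards [hx] with s hs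
  exact not_not.1 (mt (@hpZ _) hs)

theorem measure_eq_zero_of_ae_ae_orbit [SFinite μ] (hT : IsMeasurePreservingFlow T μ) {Z : Set X}
    (hZ : MeasurableSet Z) (h : ∀ᵐ x ∂μ, ∀ᵐ s : ℝ, T s x ∉ Z) : μ Z = 0 := by
  obtain ⟨s, hs⟩ := ((Measure.ae_ae_comm (p := fun s x => T s x ∉ Z)
    (hT.measurable_uncurry hZ.compl)).2 h).exists
  rw [← (hT.measurePreserving s).measure_preimage hZ.nullMeasurableSet]
  exact measure_eq_zero_iff_ae_notMem.2 hs

theorem lintegral_setLIntegral_orbit [SFinite μ] (hT : IsMeasurePreservingFlow T μ)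
    {φ : X → ℝ≥0∞} (hφ : Measurable φ) (J : Set ℝ) :
    ∫⁻ x, (∫⁻ s in J, φ (T s x)) ∂μ = volume J * ∫⁻ x, φ x ∂μ := by
  rw [lintegral_lintegral_swap (f := fun x s => φ (T s x))
    (hφ.comp hT.measurable_uncurry_flip).aemeasurable]
  simp_rw [(hT.measurePreserving _).lintegral_comp hφ]
  rw [lintegral_const, Measure.restrict_apply_univ, mul_comm]

theorem lintegral_volume_visits [SFinite μ] (hT : IsMeasurePreservingFlow T μ) {B : Set X}
    (hB : MeasurableSet B) (J : Set ℝ) :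
    ∫⁻ x, volume (J ∩ {s | T s x ∈ B}) ∂μ = volume J * μ B := by
  rw [← lintegral_indicator_one hB,
    ← hT.lintegral_setLIntegral_orbit (measurable_one.indicator hB) J]
  refine lintegral_congr fun x => ?_
  have hBx : MeasurableSet {s | T s x ∈ B} := hT.measurable_orbit x hB
  rw [inter_comm, ← Measure.restrict_apply hBx, ← lintegral_indicator_one hBx]
  rfl

theorem setIntegral_comp {E : Type*} [NormedAddCommGroup E] [NormedSpace ℝ E]
    (hT : IsMeasurePreservingFlow T μ) {φ : X → E} (hφ : AEStronglyMeasurable φ μ) {C : Set X}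
    (hC : MeasurableSet C) (t : ℝ) :
    ∫ x in C, φ (T t x) ∂μ = ∫ x in T (-t) ⁻¹' C, φ x ∂μ := by
  have hpre : T t ⁻¹' (T (-t) ⁻¹' C) = C := by
    ext x
    rw [mem_preimage, mem_preimage, hT.map_neg_map]
  have hmap := (hT.measurePreserving t).map_eq
  have h := setIntegral_map (μ := μ) (f := φ) (hT.measurable_map (-t) hC) (hmap.symm ▸ hφ)
    (hT.measurable_map t).aemeasurable
  rw [hpre, hmap] at h
  exact h.symm

/-- The points with almost all of their orbit in `φ ⁻¹' U` form a set that is invariant under every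
`T t` without exceptional points, as `IsErgodicFlow` requires. -/
theorem ae_eq_const_of_ae_invariant [SFinite μ] (hT : IsMeasurePreservingFlow T μ)
    (herg : IsErgodicFlow T μ) {φ : X → ℝ} (hφ : Measurable φ)
    (hinv : ∀ t, φ ∘ T t =ᵐ[μ] φ) : ∃ c : ℝ, φ =ᵐ[μ] fun _ => c := by
  have hconst : ∀ᵐ x ∂μ, ∀ᵐ s : ℝ, φ (T s x) = φ x :=
    (Measure.ae_ae_comm (p := fun s x => φ (T s x) = φ x)
      (measurableSet_eq_fun (hφ.comp hT.measurable_uncurry) (hφ.comp measurable_snd))).1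
      (.of_forall hinv)
  refine exists_eventuallyEq_const_of_forall_separating MeasurableSet fun U hU => ?_
  set B : Set X := {x | ∀ᵐ s : ℝ, φ (T s x) ∈ U} with hB
  have hBm : MeasurableSet B :=
    measurable_measure_prodMk_left (hφ.comp hT.measurable_uncurry_flip hU.compl)
      (measurableSet_singleton 0)
  have hBinv : ∀ t, T t ⁻¹' B = B := fun t => by
    ext x
    exact hT.ae_map_map_iff (fun y => φ y ∈ U) t x
  have hBU : ∀ᵐ x ∂μ, x ∈ B ↔ φ x ∈ U := by
    filter_upwards [hconst] with x hx
    rw [hB, mem_ofPred_eq, eventually_congr (hx.mono fun s hs => by rw [hs]), eventually_const]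
  rcases herg B hBm hBinv with h | h
  · right
    filter_upwards [hBU, measure_eq_zero_iff_ae_notMem.1 h] with x hxU hxB
    rwa [← hxU]
  · left
    filter_upwards [hBU, measure_eq_zero_iff_ae_notMem.1 h] with x hxU hxB
    rwa [← hxU, ← notMem_compl_iff]

end IsMeasurePreservingFlow

end AbstractFlow

/-! ### Orbit integrals -/

section OrbitIntegral

variable {X : Type*} {T : ℝ → X → X} {f g : X → ℝ}

/-- Local integrability of `f` along every orbit of `T`, so that `orbitIntegral T f` never takes a
junk value. -/
def OrbitLocallyIntegrable (T : ℝ → X → X) (f : X → ℝ) : Prop :=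
  ∀ x, LocallyIntegrable fun s => f (T s x)

namespace OrbitLocallyIntegrable

theorem intervalIntegrable (hf : OrbitLocallyIntegrable T f) (x : X) (a b : ℝ) :
    IntervalIntegrable (fun s => f (T s x)) volume a b :=
  ((hf x).integrableOn_isCompact isCompact_uIcc).intervalIntegrable

theorem continuous_orbitIntegral (hf : OrbitLocallyIntegrable T f) (x : X) :
    Continuous fun t => orbitIntegral T f t x :=
  intervalIntegral.continuous_primitive (hf.intervalIntegrable x) 0

theorem sub (hf : OrbitLocallyIntegrable T f) (hg : OrbitLocallyIntegrable T g) :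
    OrbitLocallyIntegrable T (f - g) := fun x => (hf x).sub (hg x)

theorem orbitIntegral_add (hf : OrbitLocallyIntegrable T f) (hg : OrbitLocallyIntegrable T g)
    (t : ℝ) (x : X) :
    orbitIntegral T (f + g) t x = orbitIntegral T f t x + orbitIntegral T g t x :=
  intervalIntegral.integral_add (hf.intervalIntegrable x 0 t) (hg.intervalIntegrable x 0 t)

end OrbitLocallyIntegrable

variable [MeasurableSpace X] {μ : Measure X}

namespace OrbitLocallyIntegrable

theorem of_bounded (hT : IsMeasurableFlow T) (hf : Measurable f) {M : ℝ} (hM : ∀ x, |f x| ≤ M) :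
    OrbitLocallyIntegrable T f := fun x =>
  (locallyIntegrable_const M).mono (hf.comp (hT.measurable_orbit x)).aestronglyMeasurable
    (.of_forall fun s => (hM (T s x)).trans (le_abs_self M))

theorem orbitIntegral_add_time (hf : OrbitLocallyIntegrable T f) (hT : IsMeasurableFlow T)
    (s t : ℝ) (x : X) :
    orbitIntegral T f (s + t) x = orbitIntegral T f s x + orbitIntegral T f t (T s x) := by
  simp only [orbitIntegral, ← hT.map_add]
  rw [intervalIntegral.integral_comp_add_left (fun u => f (T u x)), add_zero,
    intervalIntegral.integral_add_adjacent_intervals (hf.intervalIntegrable _ _ _)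
      (hf.intervalIntegrable _ _ _)]

theorem orbitIntegral_sub_time (hf : OrbitLocallyIntegrable T f) (hT : IsMeasurableFlow T)
    (s s' : ℝ) (x : X) :
    orbitIntegral T f (s' - s) (T s x) = orbitIntegral T f s' x - orbitIntegral T f s x := by
  rw [eq_sub_iff_add_eq', ← hf.orbitIntegral_add_time hT, add_sub_cancel]

theorem ae_hasDerivAt_orbitIntegral (hf : OrbitLocallyIntegrable T f) (hT : IsMeasurableFlow T)
    (x : X) :
    ∀ᵐ s : ℝ, HasDerivAt (fun t => orbitIntegral T f t (T s x)) (f (T s x)) 0 := by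
  filter_upwards [LocallyIntegrable.ae_hasDerivAt_integral (hf x)] with s hs
  have hs' : HasDerivAt (fun t => orbitIntegral T f t x) (f (T s x)) (s + 0) := by
    rw [add_zero]
    exact hs 0
  simpa only [hf.orbitIntegral_add_time hT, add_sub_cancel_left] using
    (hs'.comp_const_add s 0).sub_const (orbitIntegral T f s x)

end OrbitLocallyIntegrable

theorem measurable_orbitIntegral (hT : IsMeasurableFlow T) (hf : Measurable f) (t : ℝ) :
    Measurable (orbitIntegral T f t) := by
  have h : StronglyMeasurable (Function.uncurry fun x s => f (T s x)) :=
    (hf.comp hT.measurable_uncurry_flip).stronglyMeasurable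
  exact (h.integral_prod_right.sub h.integral_prod_right).measurable

theorem measurable_uncurry_orbitIntegral (hT : IsMeasurableFlow T) (hf : Measurable f)
    (hf' : OrbitLocallyIntegrable T f) : Measurable (Function.uncurry (orbitIntegral T f)) :=
  measurable_uncurry_of_continuous_of_measurable hf'.continuous_orbitIntegral
    (measurable_orbitIntegral hT hf)

theorem locallyIntegrable_iff_forall_nat {φ : ℝ → ℝ} :
    LocallyIntegrable φ ↔ ∀ n : ℕ, IntegrableOn φ (Icc (-n) n) := by
  rw [locallyIntegrable_iff]
  refine ⟨fun h n => h _ isCompact_Icc, fun h k hk => ?_⟩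
  obtain ⟨R, hR⟩ := hk.isBounded.subset_closedBall 0
  obtain ⟨n, hn⟩ := exists_nat_ge R
  refine (h n).mono_set (hR.trans ?_)
  rw [Real.closedBall_eq_Icc, zero_sub, zero_add]
  exact Icc_subset_Icc (neg_le_neg hn) hn

theorem measurableSet_locallyIntegrable_orbit (hT : IsMeasurableFlow T) (hf : Measurable f) :
    MeasurableSet {x | LocallyIntegrable fun s => f (T s x)} := by
  simp only [locallyIntegrable_iff_forall_nat, ofPred_forall]
  exact MeasurableSet.iInter fun n =>
    measurableSet_integrable (hf.comp hT.measurable_uncurry_flip).stronglyMeasurable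

theorem ae_locallyIntegrable_orbit [SFinite μ] (hT : IsMeasurePreservingFlow T μ)
    (hf : Measurable f) (hfμ : Integrable f μ) :
    ∀ᵐ x ∂μ, LocallyIntegrable fun s => f (T s x) := by
  simp only [locallyIntegrable_iff_forall_nat, ae_all_iff]
  intro n
  have hfin : ∫⁻ x, (∫⁻ s in Icc (-n : ℝ) n, ‖f (T s x)‖ₑ) ∂μ ≠ ∞ := by
    rw [hT.lintegral_setLIntegral_orbit hf.enorm, Real.volume_Icc]
    exact ENNReal.mul_ne_top ENNReal.ofReal_ne_top hfμ.2.ne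
  have hmeas : Measurable fun x => ∫⁻ s in Icc (-n : ℝ) n, ‖f (T s x)‖ₑ :=
    (hf.comp hT.measurable_uncurry_flip).enorm.lintegral_prod_right'
  filter_upwards [ae_lt_top hmeas hfin] with x hx
  exact ⟨(hf.comp (hT.measurable_orbit x)).aestronglyMeasurable, hx⟩

theorem locallyIntegrable_orbit_map_iff (hT : IsMeasurableFlow T) (t : ℝ) (x : X) :
    (LocallyIntegrable fun s => f (T s (T t x))) ↔ LocallyIntegrable fun s => f (T s x) := by
  have h := locallyIntegrable_map_homeomorph (Homeomorph.addRight t) (f := fun s => f (T s x))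
    (μ := volume)
  rw [Homeomorph.coe_addRight, map_add_right_eq_self] at h
  simp only [h, ← hT.map_add, add_comm t]
  rfl

theorem exists_measurable_ae_eq_orbitLocallyIntegrable [SFinite μ]
    (hT : IsMeasurePreservingFlow T μ) (hf : Integrable f μ) :
    ∃ g : X → ℝ, Measurable g ∧ f =ᵐ[μ] g ∧ OrbitLocallyIntegrable T g := by
  obtain ⟨h, hh, hfh⟩ : ∃ h, Measurable h ∧ f =ᵐ[μ] h := hf.1.aemeasurable
  set Ω : Set X := {x | LocallyIntegrable fun s => h (T s x)}
  have hΩ : ∀ x s, T s x ∈ Ω ↔ x ∈ Ω := fun x s =>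
    locallyIntegrable_orbit_map_iff hT.toIsMeasurableFlow s x
  refine ⟨Ω.indicator h,
    hh.indicator (measurableSet_locallyIntegrable_orbit hT.toIsMeasurableFlow hh), ?_,
    fun x => ?_⟩
  · filter_upwards [hfh, ae_locallyIntegrable_orbit hT hh (hf.congr hfh)] with x hx hxΩ
    rw [hx, indicator_of_mem hxΩ]
  · by_cases hx : x ∈ Ω
    · simp only [indicator_of_mem ((hΩ x _).2 hx)]
      exact hx
    · simpa only [indicator_of_notMem (mt (hΩ x _).1 hx)] using locallyIntegrable_zero

end OrbitIntegral

/-! ### Density of the functions with bounded orbit integrals -/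

section Coboundaries

variable {X : Type*} [MeasurableSpace X] {T : ℝ → X → X} {μ : Measure X} {f g h : X → ℝ}

/-- A bounded measurable function whose orbit integrals are bounded uniformly in time and space;
the coboundaries `g - g ∘ T s` of bounded measurable `g` are of this kind. -/
structure HasBoundedOrbitIntegrals (T : ℝ → X → X) (g : X → ℝ) : Prop where
  measurable : Measurable g
  bounded : ∃ M, ∀ x, |g x| ≤ M
  bounded_orbitIntegral : ∃ C, ∀ t x, |orbitIntegral T g t x| ≤ C

namespace HasBoundedOrbitIntegrals

theorem orbitLocallyIntegrable (hg : HasBoundedOrbitIntegrals T g) (hT : IsMeasurableFlow T) :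
    OrbitLocallyIntegrable T g :=
  hg.bounded.elim fun _ hM => .of_bounded hT hg.measurable hM

theorem memLp [IsFiniteMeasure μ] (hg : HasBoundedOrbitIntegrals T g) (p : ℝ≥0∞) :
    MemLp g p μ :=
  hg.bounded.elim fun M hM => .of_bound hg.measurable.aestronglyMeasurable M (.of_forall hM)

theorem zero : HasBoundedOrbitIntegrals T (fun _ : X => (0 : ℝ)) :=
  ⟨measurable_const, ⟨0, by simp⟩, ⟨0, by simp [orbitIntegral]⟩⟩

theorem add (hT : IsMeasurableFlow T) (hg : HasBoundedOrbitIntegrals T g)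
    (hh : HasBoundedOrbitIntegrals T h) : HasBoundedOrbitIntegrals T (g + h) := by
  obtain ⟨M, hM⟩ := hg.bounded
  obtain ⟨N, hN⟩ := hh.bounded
  obtain ⟨C, hC⟩ := hg.bounded_orbitIntegral
  obtain ⟨D, hD⟩ := hh.bounded_orbitIntegral
  refine ⟨hg.measurable.add hh.measurable, ⟨M + N, fun x => ?_⟩, ⟨C + D, fun t x => ?_⟩⟩
  · exact (abs_add_le _ _).trans (add_le_add (hM x) (hN x))
  · rw [(hg.orbitLocallyIntegrable hT).orbitIntegral_add (hh.orbitLocallyIntegrable hT)]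
    exact (abs_add_le _ _).trans (add_le_add (hC t x) (hD t x))

theorem const_smul (hg : HasBoundedOrbitIntegrals T g) (c : ℝ) :
    HasBoundedOrbitIntegrals T (c • g) := by
  obtain ⟨M, hM⟩ := hg.bounded
  obtain ⟨C, hC⟩ := hg.bounded_orbitIntegral
  have hc : ∀ {a b : ℝ}, |a| ≤ b → |c * a| ≤ |c| * b := fun h => by
    rw [abs_mul]
    exact mul_le_mul_of_nonneg_left h (abs_nonneg c)
  refine ⟨hg.measurable.const_smul c, ⟨|c| * M, fun x => hc (hM x)⟩, ⟨|c| * C, fun t x => ?_⟩⟩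
  rw [show orbitIntegral T (c • g) t x = c * orbitIntegral T g t x from
    intervalIntegral.integral_const_mul c _]
  exact hc (hC t x)

theorem orbitIntegral_sub_comp (hT : IsMeasurableFlow T) (hg : OrbitLocallyIntegrable T g)
    (s t : ℝ) (x : X) :
    orbitIntegral T (fun x => g x - g (T s x)) t x =
      orbitIntegral T g s x - orbitIntegral T g s (T t x) := by
  have h : orbitIntegral T (fun x => g x - g (T s x)) t x =
      orbitIntegral T g t x - orbitIntegral T g t (T s x) := by
    simp only [orbitIntegral, ← hT.map_add, add_comm _ s]
    refine intervalIntegral.integral_sub (hg.intervalIntegrable x 0 t) ?_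
    simpa only [hT.map_add] using hg.intervalIntegrable (T s x) 0 t
  rw [h, sub_eq_sub_iff_add_eq_add, ← hg.orbitIntegral_add_time hT, add_comm t,
    hg.orbitIntegral_add_time hT]

theorem sub_comp (hT : IsMeasurableFlow T) (hg : Measurable g) {M : ℝ} (hM : ∀ x, |g x| ≤ M)
    (s : ℝ) : HasBoundedOrbitIntegrals T (fun x => g x - g (T s x)) := by
  have hpiece : ∀ x, |orbitIntegral T g s x| ≤ M * |s| := fun x => by
    have h := intervalIntegral.norm_integral_le_of_norm_le_const (a := 0) (b := s)
      (f := fun u => g (T u x)) fun u _ => hM (T u x)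
    rwa [sub_zero] at h
  refine ⟨hg.sub (hg.comp (hT.measurable_map s)), ⟨M + M, fun x => ?_⟩,
    ⟨M * |s| + M * |s|, fun t x => ?_⟩⟩
  · exact (abs_sub _ _).trans (add_le_add (hM x) (hM _))
  · rw [orbitIntegral_sub_comp hT (.of_bounded hT hg hM)]
    exact (abs_sub _ _).trans (add_le_add (hpiece x) (hpiece _))

variable (μ) in
/-- The subspace of `L²` formed by the classes of functions with bounded orbit integrals. -/
def submodule (hT : IsMeasurableFlow T) : Submodule ℝ (Lp ℝ 2 μ) where
  carrier := {φ | ∃ g, HasBoundedOrbitIntegrals T g ∧ φ =ᵐ[μ] g}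
  zero_mem' := ⟨_, zero, Lp.coeFn_zero ℝ 2 μ⟩
  add_mem' := by
    rintro φ ψ ⟨g, hg, hφ⟩ ⟨h, hh, hψ⟩
    exact ⟨g + h, hg.add hT hh, (Lp.coeFn_add φ ψ).trans (hφ.add hψ)⟩
  smul_mem' := by
    rintro c φ ⟨g, hg, hφ⟩
    exact ⟨c • g, hg.const_smul c, (Lp.coeFn_smul c φ).trans (hφ.const_smul c)⟩

theorem integral_mul_eq_zero_of_mem_orthogonal [IsFiniteMeasure μ] (hT : IsMeasurableFlow T)
    {φ : Lp ℝ 2 μ} (hφ : φ ∈ (submodule μ hT)ᗮ) (hg : HasBoundedOrbitIntegrals T g) :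
    ∫ x, g x * φ x ∂μ = 0 := by
  have hg2 : MemLp g 2 μ := hg.memLp 2
  have h0 := (Submodule.mem_orthogonal _ _).1 hφ (hg2.toLp g) ⟨g, hg, hg2.coeFn_toLp⟩
  rw [L2.inner_def] at h0
  rw [← h0]
  refine integral_congr_ae ?_
  filter_upwards [hg2.coeFn_toLp] with x hx
  rw [hx, Real.inner_apply]

theorem ae_eq_const_of_mem_orthogonal [IsFiniteMeasure μ] (hT : IsMeasurePreservingFlow T μ)
    (herg : IsErgodicFlow T μ) {φ : Lp ℝ 2 μ}
    (hφ : φ ∈ (submodule μ hT.toIsMeasurableFlow)ᗮ) : ∃ c : ℝ, φ =ᵐ[μ] fun _ => c := by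
  have hint : Integrable φ μ := (Lp.memLp φ).integrable one_le_two
  refine hT.ae_eq_const_of_ae_invariant herg (Lp.stronglyMeasurable φ).measurable fun t => ?_
  refine ae_eq_of_forall_setIntegral_eq_of_sigmaFinite
    (fun _ _ _ => ((hT.measurePreserving t).integrable_comp_of_integrable hint).integrableOn)
    (fun _ _ _ => hint.integrableOn) fun C hC _ => ?_
  have hTC : MeasurableSet (T (-t) ⁻¹' C) := hT.measurable_map (-t) hC
  have hbdd : ∀ x, |C.indicator (1 : X → ℝ) x| ≤ 1 := fun x => by
    simpa using norm_indicator_le_norm_self (1 : X → ℝ) x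
  have horth := integral_mul_eq_zero_of_mem_orthogonal _ hφ
    (sub_comp hT.toIsMeasurableFlow (measurable_one.indicator hC) hbdd (-t))
  have hind : ∀ x, (C.indicator 1 x - C.indicator 1 (T (-t) x)) * φ x =
      C.indicator φ x - (T (-t) ⁻¹' C).indicator φ x := fun x => by
    classical
    simp only [indicator_apply, mem_preimage, Pi.one_apply]
    split_ifs <;> ring
  rw [integral_congr_ae (.of_forall hind),
    integral_sub (hint.indicator hC) (hint.indicator hTC), integral_indicator hC,
    integral_indicator hTC, sub_eq_zero] at horth
  exact (hT.setIntegral_comp hint.1 hC t).trans horth.symm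

theorem toLp_mem_topologicalClosure_submodule [IsFiniteMeasure μ]
    (hT : IsMeasurePreservingFlow T μ) (herg : IsErgodicFlow T μ) (hh : MemLp h 2 μ)
    (hh_mean : ∫ x, h x ∂μ = 0) :
    hh.toLp h ∈ (submodule μ hT.toIsMeasurableFlow).topologicalClosure := by
  rw [← Submodule.orthogonal_orthogonal_eq_closure, Submodule.mem_orthogonal]
  intro φ hφ
  obtain ⟨c, hc⟩ := ae_eq_const_of_mem_orthogonal hT herg hφ
  calc inner ℝ φ (hh.toLp h) = ∫ x, h x * c ∂μ := by
        rw [L2.inner_def]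
        refine integral_congr_ae ?_
        filter_upwards [hc, hh.coeFn_toLp] with x hφx hhx
        rw [hφx, hhx, Real.inner_apply, mul_comm]
    _ = 0 := by rw [integral_mul_const, hh_mean, zero_mul]

theorem exists_eLpNorm_two_sub_lt [IsFiniteMeasure μ] (hT : IsMeasurePreservingFlow T μ)
    (herg : IsErgodicFlow T μ) (hh : MemLp h 2 μ) (hh_mean : ∫ x, h x ∂μ = 0) {ε : ℝ≥0∞}
    (hε : ε ≠ 0) : ∃ g, HasBoundedOrbitIntegrals T g ∧ eLpNorm (h - g) 2 μ < ε := by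
  have hmem := toLp_mem_topologicalClosure_submodule hT herg hh hh_mean
  rw [← SetLike.mem_coe, Submodule.topologicalClosure_coe, EMetric.mem_closure_iff] at hmem
  obtain ⟨ψ, ⟨g, hg, hψ⟩, hψε⟩ := hmem ε (pos_iff_ne_zero.2 hε)
  rw [Lp.edist_def, eLpNorm_congr_ae (hh.coeFn_toLp.sub hψ)] at hψε
  exact ⟨g, hg, hψε⟩

end HasBoundedOrbitIntegrals

theorem exists_memLp_integral_eq_zero_eLpNorm_one_sub_le {E : Type*} [NormedAddCommGroup E]
    [NormedSpace ℝ E] [CompleteSpace E] [IsFiniteMeasure μ] {f : X → E} (hf : Integrable f μ)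
    (hf_mean : ∫ x, f x ∂μ = 0) (p : ℝ≥0∞) {ε : ℝ≥0∞} (hε : ε ≠ 0) :
    ∃ h : X → E, MemLp h p μ ∧ ∫ x, h x ∂μ = 0 ∧ eLpNorm (f - h) 1 μ ≤ ε := by
  obtain ⟨k, hkp, hki, hk⟩ :
      ∃ k : X → E, MemLp k p μ ∧ Integrable k μ ∧ eLpNorm (f - k) 1 μ < ε / 2 := by
    obtain ⟨k, hk, -⟩ := (memLp_one_iff_integrable.2 hf).exists_simpleFunc_eLpNorm_sub_lt
      ENNReal.one_ne_top (ENNReal.half_pos hε).ne'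
    exact ⟨k, k.memLp_of_isFiniteMeasure p μ, k.integrable_of_isFiniteMeasure, hk⟩
  refine ⟨fun x => k x - ⨍ y, k y ∂μ,
    hkp.sub (memLp_const _), integral_sub_average μ k, ?_⟩
  have hmean : eLpNorm (fun _ : X => ⨍ y, k y ∂μ) 1 μ ≤ ε / 2 := by
    calc eLpNorm (fun _ : X => ⨍ y, k y ∂μ) 1 μ = ‖∫ x, k x ∂μ‖ₑ := by
          rw [eLpNorm_one_eq_lintegral_enorm, lintegral_const, ← measure_smul_average, enorm_smul,
            mul_comm, Real.enorm_of_nonneg measureReal_nonneg, ofReal_measureReal]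
      _ = ‖∫ x, (f - k) x ∂μ‖ₑ := by
          rw [integral_sub' hf hki, hf_mean, zero_sub, enorm_neg]
      _ ≤ eLpNorm (f - k) 1 μ := by
          rw [eLpNorm_one_eq_lintegral_enorm]
          exact enorm_integral_le_lintegral_enorm _
      _ ≤ ε / 2 := hk.le
  calc eLpNorm (f - fun x => k x - ⨍ y, k y ∂μ) 1 μ
      = eLpNorm ((f - k) + fun _ => ⨍ y, k y ∂μ) 1 μ := by
        congr 1
        ext x
        simp only [Pi.sub_apply, Pi.add_apply]
        abel
    _ ≤ eLpNorm (f - k) 1 μ + eLpNorm (fun _ : X => ⨍ y, k y ∂μ) 1 μ :=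
        eLpNorm_add_le (hf.1.sub hki.1) aestronglyMeasurable_const le_rfl
    _ ≤ ε / 2 + ε / 2 := add_le_add hk.le hmean
    _ = ε := ENNReal.add_halves ε

theorem exists_hasBoundedOrbitIntegrals_eLpNorm_one_sub_le [IsFiniteMeasure μ]
    (hT : IsMeasurePreservingFlow T μ) (herg : IsErgodicFlow T μ) (hf : Integrable f μ)
    (hf_mean : ∫ x, f x ∂μ = 0) {ε : ℝ≥0∞} (hε : ε ≠ 0) :
    ∃ g, HasBoundedOrbitIntegrals T g ∧ eLpNorm (f - g) 1 μ ≤ ε := by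
  have hε2 : ε / 2 ≠ 0 := (ENNReal.half_pos hε).ne'
  obtain ⟨h, hh, hh_mean, hfh⟩ :=
    exists_memLp_integral_eq_zero_eLpNorm_one_sub_le hf hf_mean 2 hε2
  obtain ⟨δ, hδ, hδε⟩ := ENNReal.exists_nnreal_pos_mul_lt
    (ENNReal.rpow_ne_top_of_nonneg one_half_pos.le (measure_ne_top μ univ)) hε2
  obtain ⟨g, hg, hhg⟩ := HasBoundedOrbitIntegrals.exists_eLpNorm_two_sub_lt hT herg hh hh_mean
    (ENNReal.coe_ne_zero.2 hδ.ne')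
  have hgm : AEStronglyMeasurable g μ := hg.measurable.aestronglyMeasurable
  refine ⟨g, hg, ?_⟩
  calc eLpNorm (f - g) 1 μ = eLpNorm ((f - h) + (h - g)) 1 μ := by rw [sub_add_sub_cancel]
    _ ≤ eLpNorm (f - h) 1 μ + eLpNorm (h - g) 1 μ :=
        eLpNorm_add_le (hf.1.sub hh.1) (hh.1.sub hgm) le_rfl
    _ ≤ ε / 2 + ε / 2 := by
        refine add_le_add hfh ?_
        calc eLpNorm (h - g) 1 μ ≤ eLpNorm (h - g) 2 μ * μ univ ^ (1 / 2 : ℝ) := by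
              convert eLpNorm_le_eLpNorm_mul_rpow_measure_univ one_le_two (hh.1.sub hgm) using 3
              norm_num
          _ ≤ δ * μ univ ^ (1 / 2 : ℝ) := mul_le_mul_left hhg.le _
          _ ≤ ε / 2 := hδε.le
    _ = ε := ENNReal.add_halves ε

end Coboundaries

/-! ### The maximal orbit integral -/

section Maximal

variable {X : Type*} {T : ℝ → X → X} {f g : X → ℝ}

/-- The maximal function `sup_{0 ≤ t ≤ L} |Φ(t, x)|` of the orbit integrals up to time `L`. -/
noncomputable def maximalOrbitIntegral (T : ℝ → X → X) (f : X → ℝ) (L : ℝ) (x : X) : ℝ≥0∞ :=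
  ⨆ t ∈ Icc 0 L, ‖orbitIntegral T f t x‖ₑ

theorem enorm_orbitIntegral_le_maximalOrbitIntegral {t L : ℝ} (ht : t ∈ Icc 0 L) (x : X) :
    ‖orbitIntegral T f t x‖ₑ ≤ maximalOrbitIntegral T f L x :=
  le_iSup₂ (f := fun t _ => ‖orbitIntegral T f t x‖ₑ) t ht

theorem enorm_orbitIntegral_le_setLIntegral {t L : ℝ} (ht : t ∈ Icc 0 L) (x : X) :
    ‖orbitIntegral T f t x‖ₑ ≤ ∫⁻ s in Ioc 0 L, ‖f (T s x)‖ₑ := by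
  rw [orbitIntegral, intervalIntegral.integral_of_le ht.1]
  exact (enorm_integral_le_lintegral_enorm _).trans (lintegral_mono_set (Ioc_subset_Ioc_right ht.2))

theorem maximalOrbitIntegral_le (hf : OrbitLocallyIntegrable T f)
    (hg : OrbitLocallyIntegrable T g) {C : ℝ} (hC : ∀ t x, |orbitIntegral T g t x| ≤ C) (L : ℝ)
    (x : X) :
    maximalOrbitIntegral T f L x ≤
      ENNReal.ofReal C + ∫⁻ s in Ioc 0 L, ‖(f - g) (T s x)‖ₑ := by
  refine iSup₂_le fun t ht => ?_
  have hsplit : orbitIntegral T f t x = orbitIntegral T g t x + orbitIntegral T (f - g) t x := by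
    rw [← hg.orbitIntegral_add (hf.sub hg), add_sub_cancel]
  rw [hsplit]
  refine (enorm_add_le _ _).trans (add_le_add ?_ (enorm_orbitIntegral_le_setLIntegral ht x))
  rw [Real.enorm_eq_ofReal_abs]
  exact ENNReal.ofReal_le_ofReal (hC t x)

variable [MeasurableSpace X] {μ : Measure X}

theorem lintegral_maximalOrbitIntegral_le [SFinite μ] (hT : IsMeasurePreservingFlow T μ)
    (hf : Measurable f) (hfT : OrbitLocallyIntegrable T f) (hg : Measurable g)
    (hgT : OrbitLocallyIntegrable T g) {C : ℝ} (hC : ∀ t x, |orbitIntegral T g t x| ≤ C) (L : ℝ) :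
    ∫⁻ x, maximalOrbitIntegral T f L x ∂μ ≤
      ENNReal.ofReal C * μ univ + ENNReal.ofReal L * eLpNorm (f - g) 1 μ := by
  refine (lintegral_mono fun x => maximalOrbitIntegral_le hfT hgT hC L x).trans_eq ?_
  rw [lintegral_add_left measurable_const, lintegral_const,
    hT.lintegral_setLIntegral_orbit (hf.sub hg).enorm, Real.volume_Ioc, sub_zero,
    eLpNorm_one_eq_lintegral_enorm]

theorem tendsto_lintegral_maximalOrbitIntegral_div [IsFiniteMeasure μ]
    (hT : IsMeasurePreservingFlow T μ) (herg : IsErgodicFlow T μ) (hf : Measurable f)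
    (hfT : OrbitLocallyIntegrable T f) (hfμ : Integrable f μ) (hf_mean : ∫ x, f x ∂μ = 0) :
    Tendsto (fun L : ℝ => (∫⁻ x, maximalOrbitIntegral T f L x ∂μ) / ENNReal.ofReal L) atTop
      (𝓝 0) := by
  refine ENNReal.tendsto_nhds_zero.2 fun ε hε => ?_
  obtain ⟨g, hg, hfg⟩ := exists_hasBoundedOrbitIntegrals_eLpNorm_one_sub_le hT herg hfμ hf_mean
    (ENNReal.half_pos hε.ne').ne'
  obtain ⟨C, hC⟩ := hg.bounded_orbitIntegral
  have hlim : Tendsto (fun L : ℝ => ENNReal.ofReal C * μ univ / ENNReal.ofReal L) atTop (𝓝 0) := by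
    have hCμ : ENNReal.ofReal C * μ univ ≠ ∞ :=
      ENNReal.mul_ne_top ENNReal.ofReal_ne_top (measure_ne_top μ univ)
    simpa only [ENNReal.div_top] using
      ENNReal.Tendsto.const_div ENNReal.tendsto_ofReal_atTop (.inr hCμ)
  filter_upwards [ENNReal.tendsto_nhds_zero.1 hlim (ε / 2) (ENNReal.half_pos hε.ne'),
    eventually_gt_atTop 0] with L hCL hL
  calc (∫⁻ x, maximalOrbitIntegral T f L x ∂μ) / ENNReal.ofReal L
      ≤ (ENNReal.ofReal C * μ univ + ENNReal.ofReal L * eLpNorm (f - g) 1 μ) /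
          ENNReal.ofReal L :=
        ENNReal.div_le_div_right (lintegral_maximalOrbitIntegral_le hT hf hfT hg.measurable
          (hg.orbitLocallyIntegrable hT.toIsMeasurableFlow) hC L) _
    _ = ENNReal.ofReal C * μ univ / ENNReal.ofReal L + eLpNorm (f - g) 1 μ := by
        rw [ENNReal.add_div, mul_comm (ENNReal.ofReal L),
          ENNReal.mul_div_cancel_right (ENNReal.ofReal_pos.2 hL).ne' ENNReal.ofReal_ne_top]
    _ ≤ ε / 2 + ε / 2 := add_le_add hCL hfg
    _ = ε := ENNReal.add_halves ε

end Maximal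

/-! ### Zero returns -/

theorem hausdorffMeasure_le_of_antilipschitzWith_domRestrict {Y Z : Type*} [MetricSpace Y]
    [MeasurableSpace Y] [BorelSpace Y] [MetricSpace Z] [MeasurableSpace Z] [BorelSpace Z]
    {F : Y → Z} {E : Set Y} {K : ℝ≥0} (h : AntilipschitzWith K (E.domRestrict F)) {d : ℝ}
    (hd : 0 ≤ d) : μH[d] E ≤ (K : ℝ≥0∞) ^ d * μH[d] (F '' E) := by
  have hE := isometry_subtype_coe.hausdorffMeasure_image (.inl hd) (univ : Set E)
  rw [image_univ, Subtype.range_coe] at hE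
  rw [hE, ← range_domRestrict, ← image_univ]
  exact h.le_hausdorffMeasure_image hd univ

theorem sum_volume_le_of_antilipschitzWith_domRestrict {ι : Type*} (u : Finset ι) {F : ℝ → ℝ}
    (hF : Continuous F) {K : ℝ≥0} {V : ι → Set ℝ} (hV : ∀ i, MeasurableSet (V i))
    (hanti : ∀ i, AntilipschitzWith K ((V i).domRestrict F))
    (hdisj : (u : Set ι).PairwiseDisjoint fun i => F '' V i) :
    ∑ i ∈ u, volume (V i) ≤ K * volume (⋃ i ∈ u, F '' V i) := by
  have hmeas : ∀ i, MeasurableSet (F '' V i) := fun i =>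
    (hV i).image_of_continuousOn_injOn hF.continuousOn (injOn_iff_injective.2 (hanti i).injective)
  rw [measure_biUnion_finset hdisj fun i _ => hmeas i, Finset.mul_sum]
  refine Finset.sum_le_sum fun i _ => ?_
  simpa only [hausdorffMeasure_real, ENNReal.rpow_one] using
    hausdorffMeasure_le_of_antilipschitzWith_domRestrict (hanti i) zero_le_one

section ZeroReturns

variable {X : Type*} {T : ℝ → X → X} {f : X → ℝ} {K : ℝ≥0} {ρ N : ℝ} {E B : Set X}

/-- The points at which the orbit integral expands time distances up to `ρ` at least by the factor
`K⁻¹`. -/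
def expandingSet (T : ℝ → X → X) (f : X → ℝ) (K : ℝ≥0) (ρ : ℝ) : Set X :=
  {x | ∀ t, |t| < ρ → |t| ≤ K * |orbitIntegral T f t x|}

/-- The points whose orbit visits `E` at some time `t ≥ N` at which the orbit integral vanishes. -/
def zeroReturnSet (T : ℝ → X → X) (f : X → ℝ) (E : Set X) (N : ℝ) : Set X :=
  {x | ∃ t, N ≤ t ∧ orbitIntegral T f t x = 0 ∧ T t x ∈ E}

theorem exists_mem_expandingSet_of_hasDerivAt {x : X} {c : ℝ} (hc : c ≠ 0)
    (h : HasDerivAt (fun t => orbitIntegral T f t x) c 0) :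
    ∃ n : ℕ, x ∈ expandingSet T f n (1 / (n + 1)) := by
  obtain ⟨C, hC⟩ := (h.isTheta_sub hc).isBigO_symm.bound
  rw [prod_pure, eventually_map] at hC
  obtain ⟨ε, hε, hball⟩ := Metric.eventually_nhds_iff.1 hC
  obtain ⟨n, hnC, hnε⟩ := ((tendsto_natCast_atTop_atTop.eventually_ge_atTop C).and
    (tendsto_one_div_add_atTop_nhds_zero_nat.eventually_lt_const hε)).exists
  refine ⟨n, fun t ht => ?_⟩
  have hCt : |t| ≤ C * |orbitIntegral T f t x| := by
    simpa only [orbitIntegral, intervalIntegral.integral_same, sub_zero, Real.norm_eq_abs] using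
      hball (y := t) (by rw [Real.dist_0_eq_abs]; exact ht.trans hnε)
  exact hCt.trans (mul_le_mul_of_nonneg_right hnC (abs_nonneg _))

variable [MeasurableSpace X]

theorem measurableSet_expandingSet (hT : IsMeasurableFlow T) (hf : Measurable f)
    (hfT : OrbitLocallyIntegrable T f) (K : ℝ≥0) (ρ : ℝ) :
    MeasurableSet (expandingSet T f K ρ) := by
  have hrat : expandingSet T f K ρ =
      ⋂ q : ℚ, {x | |(q : ℝ)| < ρ → |(q : ℝ)| ≤ K * |orbitIntegral T f q x|} := by
    refine Subset.antisymm (subset_iInter fun q x hx => hx q) fun x hx t ht => ?_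
    have hopen : IsOpen {t : ℝ | |t| < ρ} := isOpen_lt continuous_abs continuous_const
    have hclosed : IsClosed {t : ℝ | |t| ≤ K * |orbitIntegral T f t x|} :=
      isClosed_le continuous_abs (continuous_const.mul (hfT.continuous_orbitIntegral x).abs)
    refine hclosed.closure_subset_iff.2 ?_
      (Rat.isDenseEmbedding_coe_real.dense.open_subset_closure_inter hopen ht)
    rintro _ ⟨hq, q, rfl⟩
    exact mem_iInter.1 hx q hq
  rw [hrat]
  exact .iInter fun q => (MeasurableSet.const _).imp (measurableSet_le measurable_const
    ((measurable_orbitIntegral hT hf q).abs.const_mul _))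

theorem antilipschitzWith_domRestrict_orbitIntegral (hT : IsMeasurableFlow T)
    (hfT : OrbitLocallyIntegrable T f) (hE : E ⊆ expandingSet T f K ρ) (x : X) (a : ℝ) :
    AntilipschitzWith K
      ((Ico a (a + ρ) ∩ {s | T s x ∈ E}).domRestrict fun t => orbitIntegral T f t x) := by
  refine AntilipschitzWith.of_le_mul_dist ?_
  rintro ⟨s, hs, hsE⟩ ⟨s', hs', -⟩
  have hss' : |s' - s| < ρ := by
    rw [abs_lt]
    constructor <;> linarith [hs.1, hs.2, hs'.1, hs'.2]
  have h := hE hsE (s' - s) hss'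
  rw [hfT.orbitIntegral_sub_time hT] at h
  rwa [dist_comm, dist_comm (Set.domRestrict _ _ _)]

theorem measurableSet_zeroReturnSet [StandardBorelSpace X] (hT : IsMeasurableFlow T)
    (hf : Measurable f) (hfT : OrbitLocallyIntegrable T f) (hρ : 0 < ρ) (hEm : MeasurableSet E)
    (hE : E ⊆ expandingSet T f K ρ) (N : ℝ) : MeasurableSet (zeroReturnSet T f E N) := by
  set Z : Set (ℝ × X) := {p | N ≤ p.1 ∧ orbitIntegral T f p.1 p.2 = 0 ∧ T p.1 p.2 ∈ E}
  have hZ : MeasurableSet Z := (measurable_fst measurableSet_Ici).inter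
    ((measurable_uncurry_orbitIntegral hT hf hfT (measurableSet_singleton 0)).inter
      (hT.measurable_uncurry hEm))
  have hwindows : zeroReturnSet T f E N =
      ⋃ n : ℤ, Prod.snd '' (Z ∩ Prod.fst ⁻¹' Ico (n • ρ) (n • ρ + ρ)) := by
    simp only [← add_one_zsmul]
    rw [← image_iUnion, ← inter_iUnion, ← preimage_iUnion, iUnion_Ico_zsmul hρ, preimage_univ,
      inter_univ]
    ext x
    simp only [zeroReturnSet, mem_image, Prod.exists, exists_eq_right]
    rfl
  rw [hwindows]
  refine .iUnion fun n => (hZ.inter (measurable_fst measurableSet_Ico)).image_of_measurable_injOn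
    measurable_snd ?_
  rintro ⟨t, x⟩ ⟨⟨-, h0, hxE⟩, ht⟩ ⟨t', x'⟩ ⟨⟨-, h0', hxE'⟩, ht'⟩ rfl
  have hinj := (antilipschitzWith_domRestrict_orbitIntegral hT hfT hE x (n • ρ)).injective
  exact Prod.ext (injOn_iff_injective.2 hinj ⟨ht, hxE⟩ ⟨ht', hxE'⟩ (h0.trans h0'.symm)) rfl

theorem disjoint_image_orbitIntegral (hT : IsMeasurableFlow T) (hfT : OrbitLocallyIntegrable T f)
    (hB : Disjoint B (zeroReturnSet T f B N)) (x : X) {J J' : Set ℝ}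
    (hJ : ∀ s ∈ J, ∀ s' ∈ J', s + N ≤ s') :
    Disjoint ((fun t => orbitIntegral T f t x) '' (J ∩ {s | T s x ∈ B}))
      ((fun t => orbitIntegral T f t x) '' (J' ∩ {s | T s x ∈ B})) := by
  refine disjoint_left.2 ?_
  rintro _ ⟨s, ⟨hs, hsB⟩, rfl⟩ ⟨s', ⟨hs', hsB'⟩, heq⟩
  refine disjoint_left.1 hB hsB ⟨s' - s, le_sub_iff_add_le'.2 (hJ s hs s' hs'), ?_, ?_⟩
  · rw [hfT.orbitIntegral_sub_time hT, sub_eq_zero]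
    exact heq
  · rwa [← hT.map_add, add_sub_cancel]

theorem sum_volume_visits_le (hT : IsMeasurableFlow T) (hfT : OrbitLocallyIntegrable T f)
    (hρ : 0 ≤ ρ) (hN : 0 ≤ N) (hBm : MeasurableSet B) (hBE : B ⊆ expandingSet T f K ρ)
    (hB : Disjoint B (zeroReturnSet T f B N)) (x : X) (n : ℕ) :
    ∑ k ∈ Finset.range n,
        volume (Ico (k * (N + ρ)) (k * (N + ρ) + ρ) ∩ {s | T s x ∈ B}) ≤
      K * (2 * maximalOrbitIntegral T f (n * (N + ρ)) x) := by
  set F : ℝ → ℝ := fun t => orbitIntegral T f t x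
  set J : ℕ → Set ℝ := fun k => Ico (k * (N + ρ)) (k * (N + ρ) + ρ)
  set V : ℕ → Set ℝ := fun k => J k ∩ {s | T s x ∈ B}
  have hNρ : 0 ≤ N + ρ := add_nonneg hN hρ
  have hstep : ∀ {k l : ℕ}, k < l → (k : ℝ) * (N + ρ) + (N + ρ) ≤ l * (N + ρ) := fun hkl => by
    rw [← add_one_mul]
    exact mul_le_mul_of_nonneg_right (by exact_mod_cast hkl) hNρ
  have hdisj : Pairwise (Function.onFun Disjoint fun k => F '' V k) :=
    (pairwise_disjoint_on _).2 fun k l hkl =>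
      disjoint_image_orbitIntegral hT hfT hB x fun s hs s' hs' => by
        linarith [hstep hkl, hs.2, hs'.1]
  have hrange : ⋃ k ∈ Finset.range n, F '' V k ⊆
      Metric.closedEBall 0 (maximalOrbitIntegral T f (n * (N + ρ)) x) := by
    refine iUnion₂_subset fun k hk => image_subset_iff.2 fun s hs => ?_
    rw [mem_preimage, Metric.mem_closedEBall, edist_zero_right]
    refine enorm_orbitIntegral_le_maximalOrbitIntegral ⟨?_, ?_⟩ x
    · exact (mul_nonneg k.cast_nonneg hNρ).trans hs.1.1
    · linarith [hstep (Finset.mem_range.1 hk), hs.1.2]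
  calc ∑ k ∈ Finset.range n, volume (V k)
      ≤ K * volume (⋃ k ∈ Finset.range n, F '' V k) :=
        sum_volume_le_of_antilipschitzWith_domRestrict _ (hfT.continuous_orbitIntegral x)
          (fun _ => measurableSet_Ico.inter (hT.measurable_orbit x hBm))
          (fun _ => antilipschitzWith_domRestrict_orbitIntegral hT hfT hBE x _)
          (hdisj.set_pairwise _)
    _ ≤ K * (2 * maximalOrbitIntegral T f (n * (N + ρ)) x) := by
        rw [← Real.volume_closedEBall 0]
        exact mul_le_mul_right (measure_mono hrange) _

variable {μ : Measure X}

theorem natCast_mul_measure_le [SFinite μ] (hT : IsMeasurePreservingFlow T μ)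
    (hfT : OrbitLocallyIntegrable T f) (hρ : 0 ≤ ρ) (hN : 0 ≤ N) (hBm : MeasurableSet B)
    (hBE : B ⊆ expandingSet T f K ρ) (hB : Disjoint B (zeroReturnSet T f B N)) (n : ℕ) :
    n * (ENNReal.ofReal ρ * μ B) ≤
      K * (2 * ∫⁻ x, maximalOrbitIntegral T f (n * (N + ρ)) x ∂μ) := by
  set J : ℕ → Set ℝ := fun k => Ico (k * (N + ρ)) (k * (N + ρ) + ρ)
  have hmeas : ∀ k, Measurable fun x => volume (J k ∩ {s | T s x ∈ B}) := fun k => by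
    have h : MeasurableSet {p : X × ℝ | p.2 ∈ J k ∧ T p.2 p.1 ∈ B} :=
      (measurable_snd measurableSet_Ico).inter (hT.measurable_uncurry_flip hBm)
    exact measurable_measure_prodMk_left h
  calc n * (ENNReal.ofReal ρ * μ B)
      = ∑ k ∈ Finset.range n, ∫⁻ x, volume (J k ∩ {s | T s x ∈ B}) ∂μ := by
        simp only [hT.lintegral_volume_visits hBm, J, Real.volume_Ico, add_sub_cancel_left,
          Finset.sum_const, Finset.card_range, nsmul_eq_mul]
    _ = ∫⁻ x, ∑ k ∈ Finset.range n, volume (J k ∩ {s | T s x ∈ B}) ∂μ :=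
        (lintegral_finsetSum _ fun k _ => hmeas k).symm
    _ ≤ ∫⁻ x, K * (2 * maximalOrbitIntegral T f (n * (N + ρ)) x) ∂μ :=
        lintegral_mono fun x => sum_volume_visits_le hT.toIsMeasurableFlow hfT hρ hN hBm hBE hB x n
    _ = K * (2 * ∫⁻ x, maximalOrbitIntegral T f (n * (N + ρ)) x ∂μ) := by
        rw [lintegral_const_mul' _ _ ENNReal.coe_ne_top,
          lintegral_const_mul' _ _ ENNReal.ofNat_ne_top]

theorem measure_eq_zero_of_disjoint_zeroReturnSet [IsFiniteMeasure μ]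
    (hT : IsMeasurePreservingFlow T μ) (herg : IsErgodicFlow T μ) (hf : Measurable f)
    (hfT : OrbitLocallyIntegrable T f) (hfμ : Integrable f μ) (hf_mean : ∫ x, f x ∂μ = 0)
    (hρ : 0 < ρ) (hN : 0 ≤ N) (hBm : MeasurableSet B) (hBE : B ⊆ expandingSet T f K ρ)
    (hB : Disjoint B (zeroReturnSet T f B N)) : μ B = 0 := by
  have hL : 0 < N + ρ := add_pos_of_nonneg_of_pos hN hρ
  set M : ℝ → ℝ≥0∞ := fun L => ∫⁻ x, maximalOrbitIntegral T f L x ∂μ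
  have hle : ∀ n : ℕ, 0 < n → ENNReal.ofReal ρ * μ B ≤
      K * 2 * ENNReal.ofReal (N + ρ) * (M (n * (N + ρ)) / ENNReal.ofReal (n * (N + ρ))) := by
    intro n hn
    have hnL : 0 < ENNReal.ofReal (n * (N + ρ)) :=
      ENNReal.ofReal_pos.2 (mul_pos (Nat.cast_pos.2 hn) hL)
    rw [← mul_div_assoc, ENNReal.le_div_iff_mul_le (.inl hnL.ne') (.inl ENNReal.ofReal_ne_top),
      ENNReal.ofReal_mul n.cast_nonneg, ENNReal.ofReal_natCast]
    calc ENNReal.ofReal ρ * μ B * (n * ENNReal.ofReal (N + ρ))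
        = n * (ENNReal.ofReal ρ * μ B) * ENNReal.ofReal (N + ρ) := by ring
      _ ≤ K * (2 * M (n * (N + ρ))) * ENNReal.ofReal (N + ρ) :=
          mul_le_mul_left (natCast_mul_measure_le hT hfT hρ.le hN hBm hBE hB n) _
      _ = K * 2 * ENNReal.ofReal (N + ρ) * M (n * (N + ρ)) := by ring
  have hlim : Tendsto (fun n : ℕ => K * 2 * ENNReal.ofReal (N + ρ) *
      (M (n * (N + ρ)) / ENNReal.ofReal (n * (N + ρ)))) atTop (𝓝 0) := by
    have hc : (K * 2 * ENNReal.ofReal (N + ρ) : ℝ≥0∞) ≠ ∞ := by finiteness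
    simpa only [mul_zero, Function.comp_apply] using ENNReal.Tendsto.const_mul
      ((tendsto_lintegral_maximalOrbitIntegral_div hT herg hf hfT hfμ hf_mean).comp
        (tendsto_natCast_atTop_atTop.atTop_mul_const hL)) (.inr hc)
  have hzero : ENNReal.ofReal ρ * μ B ≤ 0 :=
    ge_of_tendsto hlim ((eventually_gt_atTop 0).mono hle)
  exact (mul_eq_zero.1 (nonpos_iff_eq_zero.1 hzero)).resolve_left (ENNReal.ofReal_pos.2 hρ).ne'

theorem ae_mem_zeroReturnSet [StandardBorelSpace X] [IsFiniteMeasure μ]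
    (hT : IsMeasurePreservingFlow T μ) (herg : IsErgodicFlow T μ) (hf : Measurable f)
    (hfT : OrbitLocallyIntegrable T f) (hfμ : Integrable f μ) (hf_mean : ∫ x, f x ∂μ = 0)
    (hρ : 0 < ρ) (hN : 0 ≤ N) (hEm : MeasurableSet E) (hE : E ⊆ expandingSet T f K ρ) :
    ∀ᵐ x ∂μ, x ∈ E → x ∈ zeroReturnSet T f E N := by
  have hBm : MeasurableSet (E \ zeroReturnSet T f E N) :=
    hEm.diff (measurableSet_zeroReturnSet hT.toIsMeasurableFlow hf hfT hρ hEm hE N)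
  have hB : Disjoint (E \ zeroReturnSet T f E N)
      (zeroReturnSet T f (E \ zeroReturnSet T f E N) N) :=
    disjoint_left.2 fun x hx ⟨t, ht, h0, hxt⟩ => hx.2 ⟨t, ht, h0, hxt.1⟩
  have hnull := measure_eq_zero_of_disjoint_zeroReturnSet hT herg hf hfT hfμ hf_mean hρ hN hBm
    (sdiff_subset.trans hE) hB
  filter_upwards [measure_eq_zero_iff_ae_notMem.1 hnull] with x hx hxE
  exact of_not_not fun h => hx ⟨hxE, h⟩

theorem ae_exists_mem_expandingSet [SFinite μ] (hT : IsMeasurePreservingFlow T μ)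
    (hf : Measurable f) (hfT : OrbitLocallyIntegrable T f) :
    ∀ᵐ x ∂μ, f x ≠ 0 → ∃ n : ℕ, x ∈ expandingSet T f n (1 / (n + 1)) := by
  set Z : Set X := {x | f x ≠ 0} \ ⋃ n : ℕ, expandingSet T f n (1 / (n + 1))
  have hZm : MeasurableSet Z := (hf (measurableSet_singleton 0).compl).diff
    (.iUnion fun n => measurableSet_expandingSet hT.toIsMeasurableFlow hf hfT _ _)
  have hZ : μ Z = 0 := hT.measure_eq_zero_of_ae_ae_orbit hZm <| .of_forall fun x => by
    filter_upwards [hfT.ae_hasDerivAt_orbitIntegral hT.toIsMeasurableFlow x] with s hs hsZ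
    exact hsZ.2 (mem_iUnion.2 (exists_mem_expandingSet_of_hasDerivAt hsZ.1 hs))
  filter_upwards [measure_eq_zero_iff_ae_notMem.1 hZ] with x hx hfx
  exact mem_iUnion.1 (of_not_not fun h => hx ⟨hfx, h⟩)

theorem ae_forall_mem_zeroReturnSet [StandardBorelSpace X] [IsFiniteMeasure μ]
    (hT : IsMeasurePreservingFlow T μ) (herg : IsErgodicFlow T μ) (hf : Measurable f)
    (hfT : OrbitLocallyIntegrable T f) (hfμ : Integrable f μ) (hf_mean : ∫ x, f x ∂μ = 0)
    {A : Set X} (hA : MeasurableSet A) :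
    ∀ᵐ x ∂μ, x ∈ A → f x ≠ 0 → ∀ N : ℕ, x ∈ zeroReturnSet T f A N := by
  have hreturn : ∀ n N : ℕ, ∀ᵐ x ∂μ, x ∈ A ∩ expandingSet T f n (1 / (n + 1)) →
      x ∈ zeroReturnSet T f (A ∩ expandingSet T f n (1 / (n + 1))) N := fun n N =>
    ae_mem_zeroReturnSet hT herg hf hfT hfμ hf_mean Nat.one_div_pos_of_nat N.cast_nonneg
      (hA.inter (measurableSet_expandingSet hT.toIsMeasurableFlow hf hfT _ _)) inter_subset_right
  filter_upwards [ae_exists_mem_expandingSet hT hf hfT,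
    ae_all_iff.2 fun n => ae_all_iff.2 (hreturn n)] with x hexp hret hxA hfx N
  obtain ⟨n, hn⟩ := hexp hfx
  obtain ⟨t, ht, h0, hxt⟩ := hret n N ⟨hxA, hn⟩
  exact ⟨t, ht, h0, hxt.1⟩

end ZeroReturns

/-! ### The special flow -/

section Suspension

/-- The shift `(a, b) ↦ (S a, b - r a)` of `I × ℝ`. Its orbits are the classes of the identification
`(a, r a) ∼ (S a, 0)` that glues the pieces of the vertical lines to the orbits of the special
flow, and the phase space is a fundamental domain for it. -/
def suspensionShift (S : I ≃ᵐ I) (r : I → ℝ) : Equiv.Perm (I × ℝ) where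
  toFun p := (S p.1, p.2 - r p.1)
  invFun p := (S.symm p.1, p.2 + r (S.symm p.1))
  left_inv p := by simp only [MeasurableEquiv.symm_apply_apply, sub_add_cancel]
  right_inv p := by simp only [MeasurableEquiv.apply_symm_apply, add_sub_cancel_right]

/-- The vertical translation of `I × ℝ` by `t`, of which the special flow is the quotient modulo
`suspensionShift`. -/
def verticalShift (t : ℝ) (p : I × ℝ) : I × ℝ :=
  (p.1, p.2 + t)

variable {S : I ≃ᵐ I} {r : I → ℝ}

theorem suspensionShift_zpow_apply (n : ℤ) (p : I × ℝ) :
    (suspensionShift S r ^ n) p =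
      ((S.toEquiv ^ n : Equiv.Perm I) p.1, p.2 - roofSum S r p.1 n) := by
  have hstep : ∀ m : ℤ,
      ((S.toEquiv ^ (m + 1) : Equiv.Perm I) p.1, p.2 - roofSum S r p.1 (m + 1)) =
        suspensionShift S r ((S.toEquiv ^ m : Equiv.Perm I) p.1, p.2 - roofSum S r p.1 m) := by
    intro m
    rw [roofSum_add_one, ← sub_sub, add_comm, zpow_one_add]
    rfl
  have hiff : ∀ m : ℤ,
      (suspensionShift S r ^ (m + 1)) p =
          ((S.toEquiv ^ (m + 1) : Equiv.Perm I) p.1, p.2 - roofSum S r p.1 (m + 1)) ↔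
        (suspensionShift S r ^ m) p =
          ((S.toEquiv ^ m : Equiv.Perm I) p.1, p.2 - roofSum S r p.1 m) := by
    intro m
    rw [hstep, add_comm m, zpow_one_add, Equiv.Perm.mul_apply, Equiv.apply_eq_iff_eq]
  induction n using Int.induction_on with
  | zero => exact Prod.ext rfl (sub_zero p.2).symm
  | succ m ih => exact (hiff m).2 ih
  | pred m ih => exact (hiff _).1 (by rwa [sub_add_cancel])

theorem suspensionShift_zpow_verticalShift (n : ℤ) (t : ℝ) (p : I × ℝ) :
    (suspensionShift S r ^ n) (verticalShift t p) =
      verticalShift t ((suspensionShift S r ^ n) p) := by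
  simp only [suspensionShift_zpow_apply, verticalShift, sub_add_eq_add_sub]

theorem monotone_roofSum (hr : ∀ a, 0 ≤ r a) (a : I) : Monotone (roofSum S r a) :=
  monotone_int_of_le_succ fun n => by
    rw [roofSum_add_one]
    exact le_add_of_nonneg_right (hr _)

theorem suspensionShift_zpow_mem_phaseSpace_iff (n : ℤ) (p : I × ℝ) :
    (suspensionShift S r ^ n) p ∈ phaseSpace r ↔
      p.2 ∈ Ico (roofSum S r p.1 n) (roofSum S r p.1 (n + 1)) := by
  rw [suspensionShift_zpow_apply, roofSum_add_one]
  exact and_congr sub_nonneg sub_lt_iff_lt_add'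

theorem eq_of_suspensionShift_zpow_mem_phaseSpace (hr : ∀ a, 0 ≤ r a) {p : I × ℝ} {m n : ℤ}
    (hm : (suspensionShift S r ^ m) p ∈ phaseSpace r)
    (hn : (suspensionShift S r ^ n) p ∈ phaseSpace r) : m = n := by
  rw [suspensionShift_zpow_mem_phaseSpace_iff] at hm hn
  exact (monotone_roofSum hr p.1).pairwise_disjoint_on_Ico_succ.eq (not_disjoint_iff.2 ⟨_, hm, hn⟩)

theorem isComplete_iff_forall_exists_mem (p : I × ℝ) :
    IsComplete S r p.1 ↔
      ∀ t, ∃ n : ℤ, (suspensionShift S r ^ n) (verticalShift t p) ∈ phaseSpace r := by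
  simp only [suspensionShift_zpow_mem_phaseSpace_iff]
  exact (Equiv.addLeft p.2).forall_congr_right.symm

theorem isComplete_suspensionShift_zpow_iff (n : ℤ) (p : I × ℝ) :
    IsComplete S r ((suspensionShift S r ^ n) p).1 ↔ IsComplete S r p.1 := by
  simp only [isComplete_iff_forall_exists_mem]
  refine forall_congr' fun t => ?_
  simp only [← suspensionShift_zpow_verticalShift, ← Equiv.Perm.mul_apply, ← zpow_add]
  exact (Equiv.addRight n).exists_congr_right
    (q := fun m => (suspensionShift S r ^ m) (verticalShift t p) ∈ phaseSpace r)

theorem exists_mem_Ico_add_one {β : Type*} [LinearOrder β] {c : ℤ → β} {m l : ℤ} {u : β}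
    (hml : m ≤ l) (hm : c m ≤ u) (hl : u < c l) : ∃ n, u ∈ Ico (c n) (c (n + 1)) := by
  by_contra! h
  exact hl.not_ge (Int.leInduction hm (fun n _ hn => not_lt.1 fun hlt => h n ⟨hn, hlt⟩) l hml)

theorem isComplete_iff_forall_int (hr : ∀ a, 0 ≤ r a) (a : I) :
    IsComplete S r a ↔ ∀ k : ℤ, ∃ n : ℤ, (suspensionShift S r ^ n) (a, (k : ℝ)) ∈ phaseSpace r := by
  simp only [suspensionShift_zpow_mem_phaseSpace_iff]
  refine ⟨fun h k => h k, fun h u => ?_⟩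
  obtain ⟨m, hm, -⟩ := h ⌊u⌋
  obtain ⟨l, -, hl⟩ := h (⌊u⌋ + 1)
  have hmu : roofSum S r a m ≤ u := hm.trans (Int.floor_le u)
  have hul : u < roofSum S r a (l + 1) :=
    (Int.lt_floor_add_one u).trans (by rwa [Int.cast_add, Int.cast_one] at hl)
  exact exists_mem_Ico_add_one ((monotone_roofSum hr a).reflect_lt (hmu.trans_lt hul)).le hmu hul

end Suspension

section Measure

variable {S : I ≃ᵐ I} {r : I → ℝ}

theorem measurableSet_phaseSpace (hr : Measurable r) : MeasurableSet (phaseSpace r) :=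
  (measurableSet_le measurable_const measurable_snd).inter
    (measurableSet_lt measurable_snd (hr.comp measurable_fst))

theorem isFiniteMeasure_phaseMeasure (hr : Measurable r) : IsFiniteMeasure (phaseMeasure r) := by
  refine ⟨?_⟩
  rw [phaseMeasure, Measure.smul_apply, comap_subtype_coe_apply (measurableSet_phaseSpace hr),
    image_univ, Subtype.range_coe, smul_eq_mul]
  exact (ENNReal.inv_mul_le_one _).trans_lt ENNReal.one_lt_top

theorem measurePreserving_suspensionShift (hS : MeasurePreserving S volume volume)
    (hr : Measurable r) : MeasurePreserving (suspensionShift S r) volume volume :=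
  hS.skew_product (g := fun a b => b - r a) (measurable_snd.sub (hr.comp measurable_fst))
    (.of_forall fun a => (measurePreserving_sub_right volume (r a)).map_eq)

theorem measurePreserving_suspensionShift_inv (hS : MeasurePreserving S volume volume)
    (hr : Measurable r) :
    MeasurePreserving ((suspensionShift S r)⁻¹ : Equiv.Perm (I × ℝ)) volume volume :=
  (hS.symm S).skew_product (g := fun a b => b + r (S.symm a))
    (measurable_snd.add (hr.comp (S.symm.measurable.comp measurable_fst)))
    (.of_forall fun a => (measurePreserving_add_right volume (r (S.symm a))).map_eq)

theorem measurePreserving_suspensionShift_zpow (hS : MeasurePreserving S volume volume)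
    (hr : Measurable r) (n : ℤ) :
    MeasurePreserving (suspensionShift S r ^ n : Equiv.Perm (I × ℝ)) volume volume := by
  induction n using Int.induction_on with
  | zero => exact .id volume
  | succ n ih =>
    rw [zpow_add_one]
    exact ih.comp (measurePreserving_suspensionShift hS hr)
  | pred n ih =>
    rw [zpow_sub_one]
    exact ih.comp (measurePreserving_suspensionShift_inv hS hr)

theorem measurable_uncurry_verticalShift : Measurable (Function.uncurry verticalShift) :=
  (measurable_fst.comp measurable_snd).prodMk
    ((measurable_snd.comp measurable_snd).add measurable_fst)

theorem measurePreserving_verticalShift (t : ℝ) :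
    MeasurePreserving (verticalShift t) volume volume :=
  (MeasurePreserving.id volume).prod (measurePreserving_add_right volume t)

theorem measurableSet_isComplete (hS : MeasurePreserving S volume volume) (hr : Measurable r)
    (hr_nonneg : ∀ a, 0 ≤ r a) : MeasurableSet {a | IsComplete S r a} := by
  simp only [isComplete_iff_forall_int hr_nonneg, ofPred_forall, ofPred_exists]
  exact .iInter fun k => .iUnion fun n =>
    ((measurePreserving_suspensionShift_zpow hS hr n).measurable.comp measurable_prodMk_right)
      (measurableSet_phaseSpace hr)

end Measure

section Flow

variable {S : I ≃ᵐ I} {r : I → ℝ}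

theorem flow_of_not_isComplete {x : phaseSpace r} (h : ¬IsComplete S r x.1.1) (t : ℝ) :
    flow S r t x = x :=
  dif_neg h

theorem coe_flow_of_isComplete (hr : ∀ a, 0 ≤ r a) {x : phaseSpace r}
    (hx : IsComplete S r x.1.1) {t : ℝ} {n : ℤ}
    (hn : (suspensionShift S r ^ n) (verticalShift t x) ∈ phaseSpace r) :
    (flow S r t x : I × ℝ) = (suspensionShift S r ^ n) (verticalShift t x) := by
  have hchoose := (hx (x.1.2 + t)).choose_spec
  have hmem : (suspensionShift S r ^ (hx (x.1.2 + t)).choose) (verticalShift t x) ∈ phaseSpace r :=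
    (suspensionShift_zpow_mem_phaseSpace_iff _ _).2 hchoose
  rw [← eq_of_suspensionShift_zpow_mem_phaseSpace hr hmem hn, flow, dif_pos hx,
    suspensionShift_zpow_apply]
  rfl

theorem flow_zero (hr : ∀ a, 0 ≤ r a) (x : phaseSpace r) : flow S r 0 x = x := by
  by_cases hx : IsComplete S r x.1.1
  · have h0 : (suspensionShift S r ^ (0 : ℤ)) (verticalShift 0 x) = x := by
      rw [zpow_zero, Equiv.Perm.one_apply, verticalShift, add_zero]
    rw [← Subtype.coe_inj, coe_flow_of_isComplete hr hx (h0.symm ▸ x.2), h0]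
  · exact flow_of_not_isComplete hx 0

theorem flow_add (hr : ∀ a, 0 ≤ r a) (s t : ℝ) (x : phaseSpace r) :
    flow S r (s + t) x = flow S r t (flow S r s x) := by
  by_cases hx : IsComplete S r x.1.1
  · obtain ⟨m, hm⟩ := (isComplete_iff_forall_exists_mem x.1).1 hx s
    have hs := coe_flow_of_isComplete hr hx hm
    have hsx : IsComplete S r (flow S r s x).1.1 := by
      rw [hs]
      exact (isComplete_suspensionShift_zpow_iff m _).2 hx
    obtain ⟨n, hn⟩ := (isComplete_iff_forall_exists_mem _).1 hsx t
    have hnm : (suspensionShift S r ^ n) (verticalShift t (flow S r s x)) =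
        (suspensionShift S r ^ (n + m)) (verticalShift (s + t) x) := by
      rw [hs, ← suspensionShift_zpow_verticalShift, zpow_add, Equiv.Perm.mul_apply]
      simp only [verticalShift, add_assoc]
    rw [← Subtype.coe_inj, coe_flow_of_isComplete hr hsx hn, hnm,
      coe_flow_of_isComplete hr hx (hnm ▸ hn)]
  · simp only [flow_of_not_isComplete hx]

theorem flow_mem_iff_of_isComplete (hr : ∀ a, 0 ≤ r a) {x : phaseSpace r}
    (hx : IsComplete S r x.1.1) (t : ℝ) (B : Set (phaseSpace r)) :
    flow S r t x ∈ B ↔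
      ∃ n : ℤ, (suspensionShift S r ^ n) (verticalShift t x) ∈ Subtype.val '' B := by
  constructor
  · intro h
    obtain ⟨n, hn⟩ := (isComplete_iff_forall_exists_mem x.1).1 hx t
    exact ⟨n, _, h, coe_flow_of_isComplete hr hx hn⟩
  · rintro ⟨n, y, hy, hyn⟩
    have hflow : flow S r t x = y := by
      rw [← Subtype.coe_inj, hyn, coe_flow_of_isComplete hr hx (hyn ▸ y.2)]
    rwa [hflow]

theorem measurable_uncurry_flow (hS : MeasurePreserving S volume volume) (hr : Measurable r)
    (hr_nonneg : ∀ a, 0 ≤ r a) : Measurable (Function.uncurry (flow S r)) := by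
  intro B hB
  have hval : Measurable fun q : ℝ × phaseSpace r => (q.2 : I × ℝ) :=
    measurable_subtype_coe.comp measurable_snd
  have hcomplete : MeasurableSet {q : ℝ × phaseSpace r | IsComplete S r q.2.1.1} :=
    (measurable_fst.comp hval) (measurableSet_isComplete hS hr hr_nonneg)
  have hvisit : ∀ n : ℤ, MeasurableSet {q : ℝ × phaseSpace r |
      (suspensionShift S r ^ n) (verticalShift q.1 q.2) ∈ Subtype.val '' B} := fun n =>
    ((measurePreserving_suspensionShift_zpow hS hr n).measurable.comp
      (measurable_uncurry_verticalShift.comp (measurable_fst.prodMk hval)))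
      ((measurableSet_phaseSpace hr).subtype_image hB)
  convert MeasurableSet.ite hcomplete (.iUnion hvisit) (measurable_snd hB) using 1
  ext ⟨t, x⟩
  by_cases hx : IsComplete S r x.1.1
  · simp [Set.ite, hx, flow_mem_iff_of_isComplete hr_nonneg hx]
  · simp [Set.ite, hx, flow_of_not_isComplete hx]

theorem tsum_volume_inter_suspensionShift_zpow_mem (hS : MeasurePreserving S volume volume)
    (hr : Measurable r) (hr_nonneg : ∀ a, 0 ≤ r a) (t : ℝ) {D : Set (I × ℝ)}
    (hD : MeasurableSet D) (hDc : ∀ p ∈ D, IsComplete S r p.1) :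
    ∑' n : ℤ, volume (D ∩ {p | (suspensionShift S r ^ n) (verticalShift t p) ∈ phaseSpace r}) =
      volume D := by
  have hcover : ⋃ n : ℤ,
      D ∩ {p | (suspensionShift S r ^ n) (verticalShift t p) ∈ phaseSpace r} = D := by
    rw [← inter_iUnion, inter_eq_left]
    exact fun p hp => mem_iUnion.2 ((isComplete_iff_forall_exists_mem p).1 (hDc p hp) t)
  rw [← measure_iUnion, hcover]
  · exact fun m n hmn => disjoint_left.2 fun p hm hn =>
      hmn (eq_of_suspensionShift_zpow_mem_phaseSpace hr_nonneg hm.2 hn.2)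
  · exact fun n => hD.inter (((measurePreserving_suspensionShift_zpow hS hr n).comp
      (measurePreserving_verticalShift t)).measurable (measurableSet_phaseSpace hr))

theorem image_preimage_flow_inter_eq_preimage (hr : ∀ a, 0 ≤ r a) (t : ℝ)
    (B : Set (phaseSpace r)) (n : ℤ) :
    (Subtype.val '' (flow S r t ⁻¹' B) ∩ {p | IsComplete S r p.1}) ∩
        {p | (suspensionShift S r ^ n) (verticalShift t p) ∈ phaseSpace r} =
      (fun p => (suspensionShift S r ^ n) (verticalShift t p)) ⁻¹'
        ((Subtype.val '' B ∩ {p | IsComplete S r p.1}) ∩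
          {p | (suspensionShift S r ^ (-n)) (verticalShift (-t) p) ∈ phaseSpace r}) := by
  have hinv : ∀ p : I × ℝ, (suspensionShift S r ^ (-n))
      (verticalShift (-t) ((suspensionShift S r ^ n) (verticalShift t p))) = p := fun p => by
    rw [suspensionShift_zpow_verticalShift, ← Equiv.Perm.mul_apply, ← zpow_add, neg_add_cancel,
      zpow_zero, Equiv.Perm.one_apply]
    simp only [verticalShift, add_neg_cancel_right]
  ext p
  have hcomplete := isComplete_suspensionShift_zpow_iff (S := S) (r := r) n (verticalShift t p)
  constructor
  · rintro ⟨⟨⟨x, hxB, rfl⟩, hx⟩, hn⟩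
    refine ⟨⟨⟨_, hxB, coe_flow_of_isComplete hr hx hn⟩, hcomplete.2 hx⟩, ?_⟩
    rw [mem_ofPred_eq, hinv]
    exact x.2
  · rintro ⟨⟨⟨y, hyB, hyn⟩, hc⟩, hp⟩
    rw [mem_ofPred_eq, hinv] at hp
    have hpc : IsComplete S r p.1 := hcomplete.1 hc
    exact ⟨⟨⟨⟨p, hp⟩, (flow_mem_iff_of_isComplete hr hpc t B).2 ⟨n, y, hyB, hyn⟩, rfl⟩, hpc⟩,
      hyn.subst (motive := (· ∈ phaseSpace r)) y.2⟩

theorem image_preimage_flow_sdiff_isComplete (t : ℝ) (B : Set (phaseSpace r)) :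
    Subtype.val '' (flow S r t ⁻¹' B) \ {p | IsComplete S r p.1} =
      Subtype.val '' B \ {p | IsComplete S r p.1} := by
  ext p
  refine and_congr_left fun hp => exists_congr fun x => and_congr_left ?_
  rintro rfl
  rw [mem_preimage, flow_of_not_isComplete hp]

theorem volume_image_preimage_flow (hS : MeasurePreserving S volume volume) (hr : Measurable r)
    (hr_nonneg : ∀ a, 0 ≤ r a) (t : ℝ) {B : Set (phaseSpace r)} (hB : MeasurableSet B) :
    volume (Subtype.val '' (flow S r t ⁻¹' B)) = volume (Subtype.val '' B) := by
  set C : Set (I × ℝ) := {p | IsComplete S r p.1}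
  have hC : MeasurableSet C := measurable_fst (measurableSet_isComplete hS hr hr_nonneg)
  have hBC : MeasurableSet (Subtype.val '' B ∩ C) :=
    ((measurableSet_phaseSpace hr).subtype_image hB).inter hC
  have hflowBC : MeasurableSet (Subtype.val '' (flow S r t ⁻¹' B) ∩ C) :=
    ((measurableSet_phaseSpace hr).subtype_image (((measurable_uncurry_flow hS hr hr_nonneg).comp
      measurable_prodMk_left) hB)).inter hC
  have hpiece : ∀ n : ℤ, MeasurableSet
      {p | (suspensionShift S r ^ (-n)) (verticalShift (-t) p) ∈ phaseSpace r} := fun n =>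
    ((measurePreserving_suspensionShift_zpow hS hr (-n)).comp
      (measurePreserving_verticalShift (-t))).measurable (measurableSet_phaseSpace hr)
  rw [← measure_inter_add_sdiff (Subtype.val '' (flow S r t ⁻¹' B)) hC,
    image_preimage_flow_sdiff_isComplete, ← measure_inter_add_sdiff (Subtype.val '' B) hC]
  congr 1
  rw [← tsum_volume_inter_suspensionShift_zpow_mem hS hr hr_nonneg t hflowBC fun p hp => hp.2,
    ← tsum_volume_inter_suspensionShift_zpow_mem hS hr hr_nonneg (-t) hBC fun p hp => hp.2]
  refine (tsum_congr fun n => ?_).trans ((Equiv.neg ℤ).tsum_eq _)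
  rw [image_preimage_flow_inter_eq_preimage hr_nonneg]
  exact ((measurePreserving_suspensionShift_zpow hS hr n).comp
    (measurePreserving_verticalShift t)).measure_preimage (hBC.inter (hpiece n)).nullMeasurableSet

theorem measurePreserving_flow (hS : MeasurePreserving S volume volume) (hr : Measurable r)
    (hr_nonneg : ∀ a, 0 ≤ r a) (t : ℝ) :
    MeasurePreserving (flow S r t) (phaseMeasure r) (phaseMeasure r) := by
  have hmeas : Measurable (flow S r t) :=
    (measurable_uncurry_flow hS hr hr_nonneg).comp measurable_prodMk_left
  refine MeasurePreserving.smul_measure ⟨hmeas, Measure.ext fun B hB => ?_⟩ _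
  rw [Measure.map_apply hmeas hB, comap_subtype_coe_apply (measurableSet_phaseSpace hr),
    comap_subtype_coe_apply (measurableSet_phaseSpace hr),
    volume_image_preimage_flow hS hr hr_nonneg t hB]

theorem isMeasurePreservingFlow_flow (hS : MeasurePreserving S volume volume) (hr : Measurable r)
    (hr_nonneg : ∀ a, 0 ≤ r a) : IsMeasurePreservingFlow (flow S r) (phaseMeasure r) where
  measurable_uncurry := measurable_uncurry_flow hS hr hr_nonneg
  map_zero := flow_zero hr_nonneg
  map_add := flow_add hr_nonneg
  measurePreserving := measurePreserving_flow hS hr hr_nonneg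

end Flow

end SpecialFlow

theorem theorem2_general {X : Type*} [MeasurableSpace X] [StandardBorelSpace X] {T : ℝ → X → X}
    {μ : Measure X} [IsFiniteMeasure μ] (hT : SpecialFlow.IsMeasurePreservingFlow T μ)
    (herg : SpecialFlow.IsErgodicFlow T μ) {f : X → ℝ} (hf : Integrable f μ)
    (hf_mean : ∫ x, f x ∂μ = 0) {A : Set X} (hA : NullMeasurableSet A μ) :
    ∀ᵐ x ∂μ, x ∈ A → f x ≠ 0 →
      ∃ t : ℕ → ℝ, Tendsto t atTop atTop ∧
        ∀ k, IntervalIntegrable (fun s => f (T s x)) volume 0 (t k) ∧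
          SpecialFlow.orbitIntegral T f (t k) x = 0 ∧ T (t k) x ∈ A := by
  obtain ⟨g, hg, hfg, hgT⟩ := SpecialFlow.exists_measurable_ae_eq_orbitLocallyIntegrable hT hf
  obtain ⟨A', hA'A, hA', hAA'⟩ := hA.exists_measurable_subset_ae_eq
  have hg_mean : ∫ x, g x ∂μ = 0 := by rw [← hf_mean, integral_congr_ae hfg]
  filter_upwards [SpecialFlow.ae_forall_mem_zeroReturnSet hT herg hg hgT (hf.congr hfg) hg_mean hA',
    hfg, hT.ae_ae_orbit hfg, hAA'.mem_iff] with x hreturn hfgx hfg_orbit hxAA' hxA hfx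
  choose t ht h0 htA using hreturn (hxAA'.2 hxA) (hfgx ▸ hfx)
  refine ⟨t, tendsto_atTop_mono ht tendsto_natCast_atTop_atTop, fun k => ⟨?_, ?_, hA'A (htA k)⟩⟩
  · exact (hgT.intervalIntegrable x 0 (t k)).congr_ae
      (ae_restrict_of_ae (hfg_orbit.mono fun s hs => hs.symm))
  · rw [← h0 k]
    exact intervalIntegral.integral_congr_ae (hfg_orbit.mono fun s hs _ => hs)

theorem theorem2 (S : I ≃ᵐ I) (hS : MeasurePreserving S volume volume)
    (r : I → ℝ) (hr_meas : Measurable r) (hr_nonneg : ∀ a, 0 ≤ r a) (hr_int : Integrable r volume)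
    (herg : SpecialFlow.IsErgodicFlow (SpecialFlow.flow S r) (SpecialFlow.phaseMeasure r))
    (f : SpecialFlow.phaseSpace r → ℝ) (hf : Integrable f (SpecialFlow.phaseMeasure r))
    (hf_mean : ∫ x, f x ∂(SpecialFlow.phaseMeasure r) = 0)
    (A : Set (SpecialFlow.phaseSpace r))
    (hA : NullMeasurableSet A (SpecialFlow.phaseMeasure r)) :
    ∀ᵐ x ∂(SpecialFlow.phaseMeasure r), x ∈ A → f x ≠ 0 →
      ∃ t : ℕ → ℝ, Tendsto t atTop atTop ∧
        ∀ k, IntervalIntegrable (fun s => f (SpecialFlow.flow S r s x)) volume 0 (t k) ∧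
          SpecialFlow.orbitIntegral (SpecialFlow.flow S r) f (t k) x = 0 ∧
          SpecialFlow.flow S r (t k) x ∈ A := by
  have := SpecialFlow.isFiniteMeasure_phaseMeasure hr_meas
  have := (SpecialFlow.measurableSet_phaseSpace hr_meas).standardBorel
  exact theorem2_general (SpecialFlow.isMeasurePreservingFlow_flow hS hr_meas hr_nonneg) herg hf
    hf_mean hA
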